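/- Let $k$ be an algebraically closed field, let $A$ be a finitely generated commutative $k$-algebra, let $\mathfrak m_1,\dots,\mathfrak m_r$ be pairwise distinct maximal ideals of $A$, and put $M_i=A/\mathfrak m_i$ and $M=\oplus_{i=1}^r M_i$. Definitions. An augmented algebra is a (not necessarily commutative) $k$-algebra $S$ with $k$-algebra homomorphisms $\iota_S:k^r\to S$ and $\pi_S:S\to k^r$ such that $\pi_S\iota_S=\mathrm{id}$; morphisms are the $k$-algebra homomorphisms compatible with these maps. It is complete if $S\to\varprojlim_n S/(\ker\pi_S)^n$ is bijective. Let $k^r$ act componentwise on $M$, and write endomorphisms of the left $S$-module $S\otimes_{k^r}M$ on the right. A morphism $\psi:H\to S$ induces by base change a $k$-algebra homomorphism $\Pi(\psi):\mathrm{End}_H(H\otimes_{k^r}M)\to\mathrm{End}_S(S\otimes_{k^r}M)$. A lift over $S$ is a $k$-algebra homomorphism $\phi:A\to\mathrm{End}_S(S\otimes_{k^r}M)$ such that $\Pi(\pi_S)\circ\phi:A\to\mathrm{End}_{k^r}(k^r\otimes_{k^r}M)=\oplus_i\mathrm{End}_k(M_i)$ is the (right) $A$-module structure of $M$. Two lifts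 over $S$ are isomorphic if they are conjugate by an $S$-automorphism $v$ of $S\otimes_{k^r}M$ with $\Pi(\pi_S)(v)=\mathrm{id}$. Let $T=k^r\oplus\mathrm{Mat}_r(k)$ be the tangent algebra, in which $\mathrm{Mat}_r(k)$ is an ideal of square zero on which $k^r$ acts from both sides through diagonal matrices. A pre-completion of $A$ in $M$ is a complete augmented algebra $H$ with a lift $\rho$ over $H$ such that every lift $\phi$ over every complete augmented algebra $S$ is isomorphic to $\Pi(\psi)\circ\rho$ for some morphism $\psi:H\to S$, which is unique if $S=T$. The completion of $A$ in $M$ is then $\hat O^A_M=\mathrm{End}_H(H\otimes_{k^r}M)$, with the homomorphism $\rho:A\to\hat O^A_M$. Statement. A pre-completion of $A$ in $M$ exists, and for every pre-completion $(H,\rho)$ there is an isomorphism of $k$-algebras $$\hat O^A_M=\mathrm{End}_H(H\otimes_{k^r}M)\;\simeq\;\oplus_{i=1}^r\hat A_{\mathfrak m_i}$$ that carries $\rho$ to the canonical map from $A$ to the direct sum of the $\mathfrak m_i$-adic completions $\hat A_{\mathfrak m_i}=\varprojlim_n A/\mathfrak m_i^n$. -/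

import Mathlib

open scoped TensorProduct

universe u

/-- A `k`-algebra augmented over `k^r`: a (not necessarily commutative) `k`-algebra `H` with
`k`-algebra homomorphisms `ι : k^r → H` and `π : H → k^r` such that `π ∘ ι = id`.
Since `k^r` need not be central, `H` is in general not an algebra over `k^r`
in the sense of Mathlib's `Algebra`. -/
structure AugAlg (k : Type u) [Field k] (r : ℕ) where
  carrier : Type u
  [ring : Ring carrier]
  [algebra : Algebra k carrier]
  ι : (Fin r → k) →ₐ[k] carrier
  π : carrier →ₐ[k] (Fin r → k)
  π_ι : ∀ c, π (ι c) = c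

namespace AugAlg

attribute [instance] AugAlg.ring AugAlg.algebra

section Basic

variable {k : Type u} [Field k] {r : ℕ}

/-- The augmentation ideal `𝔪 = ker π`. -/
def augIdeal (H : AugAlg k r) : Ideal H.carrier := RingHom.ker H.π

/-- `H` is complete: the canonical map from `H` to `lim_n H / 𝔪 ^ n` is injective
(`hausdorff`) and surjective (`precomplete`). -/
structure IsComplete (H : AugAlg k r) : Prop where
  hausdorff : ∀ x : H.carrier, (∀ n : ℕ, x ∈ H.augIdeal ^ n) → x = 0
  precomplete : ∀ f : ℕ → H.carrier, (∀ n : ℕ, f (n + 1) - f n ∈ H.augIdeal ^ n) →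
    ∃ L : H.carrier, ∀ n : ℕ, L - f n ∈ H.augIdeal ^ n

/-- Morphisms of augmented algebras: `k`-algebra homomorphisms compatible with the maps from
`k^r` and with the augmentations. -/
@[ext]
structure Hom (H S : AugAlg k r) where
  toAlgHom : H.carrier →ₐ[k] S.carrier
  map_ι : ∀ c, toAlgHom (H.ι c) = S.ι c
  map_π : ∀ x, S.π (toAlgHom x) = H.π x

variable (k r) in
/-- The algebra `k^r`, augmented over itself. -/
def base : AugAlg k r where
  carrier := Fin r → k
  ι := AlgHom.id k _
  π := AlgHom.id k _
  π_ι _ := rfl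

/-- The augmentation of `H`, as a morphism of augmented algebras `H → k^r`. -/
def augHom (H : AugAlg k r) : Hom H (base k r) where
  toAlgHom := H.π
  map_ι := H.π_ι
  map_π _ := rfl

variable (k r) in
/-- The `r × r` tangent algebra `T = F(V) / (ker π)²`, where `V_ij = k` for all `i, j`.
As `F(V) / (ker π)² = k^r ⊕ V`, it consists of the matrices `D + ε X` over the dual
numbers `k[ε]`, with `D` a diagonal matrix and `X` an arbitrary matrix over `k`. -/
def tangentSubalgebra : Subalgebra k (Matrix (Fin r) (Fin r) (DualNumber k)) where
  carrier := {X | ∀ i j, i ≠ j → (X i j).fst = 0}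
  mul_mem' := by
    intro X Y hX hY i j hij
    rw [Matrix.mul_apply, TrivSqZeroExt.fst_sum]
    refine Finset.sum_eq_zero fun l _ => ?_
    rw [TrivSqZeroExt.fst_mul]
    by_cases h : i = l
    · subst h
      rw [hY i j hij, mul_zero]
    · rw [hX i l h, zero_mul]
  add_mem' := by
    intro X Y hX hY i j hij
    rw [Matrix.add_apply, TrivSqZeroExt.fst_add, hX i j hij, hY i j hij, add_zero]
  algebraMap_mem' := by
    intro c i j hij
    rw [Matrix.algebraMap_matrix_apply, if_neg hij, TrivSqZeroExt.fst_zero]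

variable (k r) in
/-- The `r × r` tangent algebra as an augmented algebra: `π (D + ε X)` is the diagonal of `D`. -/
def tangent : AugAlg k r where
  carrier := tangentSubalgebra k r
  ι :=
    { toFun := fun c => ⟨Matrix.diagonal fun i => TrivSqZeroExt.inl (c i), by
        intro i j hij
        rw [Matrix.diagonal_apply_ne _ hij, TrivSqZeroExt.fst_zero]⟩
      map_one' := by
        apply Subtype.ext
        simp
      map_mul' := by
        intro c d
        apply Subtype.ext
        simp [Matrix.diagonal_mul_diagonal]
      map_zero' := by
        apply Subtype.ext
        simp
      map_add' := by
        intro c d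
        apply Subtype.ext
        simp [Matrix.diagonal_add]
      commutes' := by
        intro c
        apply Subtype.ext
        refine Matrix.ext fun i j => ?_
        by_cases h : i = j
        · subst h
          change Matrix.diagonal (fun i : Fin r => (TrivSqZeroExt.inl c : DualNumber k)) i i =
            (algebraMap k (Matrix (Fin r) (Fin r) (DualNumber k)) c) i i
          simp [Matrix.algebraMap_matrix_apply, TrivSqZeroExt.algebraMap_eq_inl]
        · change Matrix.diagonal (fun i : Fin r => (TrivSqZeroExt.inl c : DualNumber k)) i j =
            (algebraMap k (Matrix (Fin r) (Fin r) (DualNumber k)) c) i j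
          simp [Matrix.algebraMap_matrix_apply, h] }
  π :=
    { toFun := fun X i => (X.1 i i).fst
      map_one' := by
        ext i
        simp
      map_mul' := by
        intro X Y
        ext i
        change ((X.1 * Y.1) i i).fst = (X.1 i i).fst * (Y.1 i i).fst
        rw [Matrix.mul_apply, TrivSqZeroExt.fst_sum, Finset.sum_eq_single i]
        · rw [TrivSqZeroExt.fst_mul]
        · intro l _ hl
          rw [TrivSqZeroExt.fst_mul, X.2 i l (Ne.symm hl), zero_mul]
        · intro h
          exact absurd (Finset.mem_univ i) h
      map_zero' := by
        ext i
        simp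
      map_add' := by
        intro X Y
        ext i
        simp
      commutes' := by
        intro c
        ext i
        change ((algebraMap k (Matrix (Fin r) (Fin r) (DualNumber k)) c) i i).fst = c
        simp [Matrix.algebraMap_matrix_apply, TrivSqZeroExt.algebraMap_eq_inl] }
  π_ι c := by
    ext i
    change ((Matrix.diagonal fun i => (TrivSqZeroExt.inl (c i) : DualNumber k)) i i).fst = c i
    simp

/-- `H` as a right module over the commutative ring `k^r`, through `ι`. -/
noncomputable instance rightModule (H : AugAlg k r) : Module (Fin r → k) H.carrier where
  smul c h := h * H.ι c
  one_smul h := by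
    change h * H.ι 1 = h
    rw [map_one, mul_one]
  mul_smul c d h := by
    change h * H.ι (c * d) = h * H.ι d * H.ι c
    rw [mul_comm c d, map_mul, mul_assoc]
  smul_zero c := zero_mul _
  smul_add c x y := add_mul _ _ _
  add_smul c d h := by
    change h * H.ι (c + d) = h * H.ι c + h * H.ι d
    rw [map_add, mul_add]
  zero_smul h := by
    change h * H.ι 0 = 0
    rw [map_zero, mul_zero]

theorem smul_def (H : AugAlg k r) (c : Fin r → k) (h : H.carrier) : c • h = h * H.ι c := rfl

instance (H : AugAlg k r) : SMulCommClass (Fin r → k) H.carrier H.carrier :=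
  ⟨fun c x y => by simp only [smul_def, smul_eq_mul, mul_assoc]⟩

instance (H : AugAlg k r) : SMulCommClass (Fin r → k) k H.carrier :=
  ⟨fun c x y => by simp only [smul_def, smul_mul_assoc]⟩

end Basic

section Functions

variable {k : Type u} [Field k] {r : ℕ}
variable (M : Fin r → Type u) [∀ i, AddCommGroup (M i)] [∀ i, Module k (M i)]

/-- `H ⊗_{k^r} M`, where `M = ⊕ M_i` is the `k^r`-module on which `k^r` acts componentwise and
`H` is a right `k^r`-module through `ι`. It is a left `H`-module through the first factor. -/
abbrev Tens (H : AugAlg k r) : Type u := H.carrier ⊗[Fin r → k] (∀ i, M i)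

/-- The `k`-algebra `End_H (H ⊗_{k^r} M)`. Endomorphisms of this left `H`-module act from the
right, so that the product `f * g` is `f` followed by `g`. -/
abbrev O (H : AugAlg k r) : Type u := (Module.End H.carrier (Tens M H))ᵐᵒᵖ

variable {M}

theorem ι_smul_one_tmul (H : AugAlg k r) (c : Fin r → k) (m : ∀ i, M i) :
    H.ι c • ((1 : H.carrier) ⊗ₜ[Fin r → k] m) = (1 : H.carrier) ⊗ₜ[Fin r → k] (c • m) := by
  rw [TensorProduct.smul_tmul', ← TensorProduct.smul_tmul, smul_def, smul_eq_mul, mul_one,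
    one_mul]

theorem tmul_eq_smul (H : AugAlg k r) (h : H.carrier) (m : ∀ i, M i) :
    h ⊗ₜ[Fin r → k] m = h • ((1 : H.carrier) ⊗ₜ[Fin r → k] m) := by
  rw [TensorProduct.smul_tmul', smul_eq_mul, mul_one]

theorem tens_ext {H : AugAlg k r} {f g : Module.End H.carrier (Tens M H)}
    (h : ∀ m : ∀ i, M i, f ((1 : H.carrier) ⊗ₜ m) = g ((1 : H.carrier) ⊗ₜ m)) : f = g := by
  ext x
  induction x using TensorProduct.induction_on with
  | zero => simp
  | add x y hx hy => rw [map_add, map_add, hx, hy]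
  | tmul a m => rw [tmul_eq_smul, map_smul, map_smul, h]

variable (M)

/-- The map `ψ ⊗ id : H ⊗_{k^r} M → S ⊗_{k^r} M` of a morphism `ψ : H → S`. -/
noncomputable def tensMap {H S : AugAlg k r} (ψ : Hom H S) : Tens M H →+ Tens M S :=
  (LinearMap.rTensor (∀ i, M i)
    ({ toFun := ψ.toAlgHom
       map_add' := map_add ψ.toAlgHom
       map_smul' := fun c x => by
        simp only [smul_def, map_mul, ψ.map_ι, RingHom.id_apply] } :
      H.carrier →ₗ[Fin r → k] S.carrier)).toAddMonoidHom

variable {M}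

theorem tensMap_tmul {H S : AugAlg k r} (ψ : Hom H S) (h : H.carrier) (m : ∀ i, M i) :
    tensMap M ψ (h ⊗ₜ m) = ψ.toAlgHom h ⊗ₜ m := rfl

theorem tensMap_smul {H S : AugAlg k r} (ψ : Hom H S) (h : H.carrier) (x : Tens M H) :
    tensMap M ψ (h • x) = ψ.toAlgHom h • tensMap M ψ x := by
  induction x using TensorProduct.induction_on with
  | zero => simp
  | add x y hx hy => rw [smul_add, map_add, hx, hy, map_add, smul_add]
  | tmul a m =>
    rw [TensorProduct.smul_tmul', tensMap_tmul, tensMap_tmul, TensorProduct.smul_tmul',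
      smul_eq_mul, smul_eq_mul, map_mul]

/-- The base change of an `H`-linear endomorphism `f` of `H ⊗ M` along `ψ : H → S`: the
`S`-linear endomorphism `s ⊗ m ↦ s • (ψ ⊗ id) (f (1 ⊗ m))` of `S ⊗_H (H ⊗ M) = S ⊗ M`. -/
noncomputable def baseChangeEnd {H S : AugAlg k r} (ψ : Hom H S)
    (f : Module.End H.carrier (Tens M H)) : Module.End S.carrier (Tens M S) :=
  let g : Tens M S →+ Tens M S := TensorProduct.liftAddHom
    { toFun := fun s =>
        { toFun := fun m => s • tensMap M ψ (f ((1 : H.carrier) ⊗ₜ m))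
          map_zero' := by simp
          map_add' := fun m n => by rw [TensorProduct.tmul_add, map_add, map_add, smul_add] }
      map_zero' := AddMonoidHom.ext fun m =>
        zero_smul S.carrier (tensMap M ψ (f ((1 : H.carrier) ⊗ₜ m)))
      map_add' := fun s t => AddMonoidHom.ext fun m =>
        add_smul s t (tensMap M ψ (f ((1 : H.carrier) ⊗ₜ m))) }
    (by
      intro c s m
      change (c • s) • tensMap M ψ (f (1 ⊗ₜ m)) = s • tensMap M ψ (f (1 ⊗ₜ (c • m)))
      rw [← ι_smul_one_tmul, map_smul, tensMap_smul, ψ.map_ι, smul_def, mul_smul])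
  { toFun := g
    map_add' := map_add g
    map_smul' := by
      intro s x
      induction x using TensorProduct.induction_on with
      | zero => simp
      | add x y hx hy => rw [smul_add, map_add, hx, hy, map_add, smul_add]
      | tmul a m =>
        change (s • a) • tensMap M ψ (f (1 ⊗ₜ m)) = s • a • tensMap M ψ (f (1 ⊗ₜ m))
        rw [smul_assoc] }

theorem baseChangeEnd_tmul {H S : AugAlg k r} (ψ : Hom H S)
    (f : Module.End H.carrier (Tens M H)) (s : S.carrier) (m : ∀ i, M i) :
    baseChangeEnd ψ f (s ⊗ₜ m) = s • tensMap M ψ (f (1 ⊗ₜ m)) := rfl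

theorem baseChangeEnd_tensMap {H S : AugAlg k r} (ψ : Hom H S)
    (f : Module.End H.carrier (Tens M H)) (x : Tens M H) :
    baseChangeEnd ψ f (tensMap M ψ x) = tensMap M ψ (f x) := by
  induction x using TensorProduct.induction_on with
  | zero => simp
  | add x y hx hy => rw [map_add, map_add, hx, hy, map_add, map_add]
  | tmul a m =>
    rw [tensMap_tmul, baseChangeEnd_tmul, ← tensMap_smul, ← map_smul, ← tmul_eq_smul]

variable (M)

/-- The algebra homomorphism `Π(ψ) : End_H (H ⊗_{k^r} M) → End_S (S ⊗_{k^r} M)` induced by a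
morphism `ψ : H → S` through the identification `S ⊗_H (H ⊗_{k^r} M) = S ⊗_{k^r} M`. -/
noncomputable def endHom {H S : AugAlg k r} (ψ : Hom H S) : O M H →ₐ[k] O M S :=
  AlgHom.ofLinearMap
    { toFun := fun f => MulOpposite.op (baseChangeEnd ψ f.unop)
      map_add' := fun f g => by
        apply MulOpposite.unop_injective
        apply tens_ext
        intro m
        simp [baseChangeEnd_tmul]
      map_smul' := fun c f => by
        apply MulOpposite.unop_injective
        apply tens_ext
        intro m
        simp only [MulOpposite.unop_op, MulOpposite.unop_smul, baseChangeEnd_tmul, one_smul,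
          LinearMap.smul_apply, RingHom.id_apply]
        rw [← algebraMap_smul H.carrier c, tensMap_smul, AlgHom.commutes, algebraMap_smul] }
    (by
      apply MulOpposite.unop_injective
      apply tens_ext
      intro m
      simp [baseChangeEnd_tmul, tensMap_tmul])
    (by
      intro f g
      apply MulOpposite.unop_injective
      apply tens_ext
      intro m
      simp only [LinearMap.coe_mk, AddHom.coe_mk, MulOpposite.unop_op, MulOpposite.unop_mul,
        baseChangeEnd_tmul, Module.End.mul_apply, one_smul, baseChangeEnd_tensMap])

variable (A : Type u) [Ring A] [Algebra k A]
variable [∀ i, Module Aᵐᵒᵖ (M i)] [∀ i, IsScalarTower k Aᵐᵒᵖ (M i)]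

/-- For right `A`-modules `M_i`, the homomorphism `A → End_H (H ⊗_{k^r} M)` given by the right
action `(h ⊗ m) a = h ⊗ m a`. For `H = k^r` this is the direct sum `⊕ η_{M_i}` of the structure
morphisms, with values in `End_{k^r} (k^r ⊗_{k^r} M) = ⊕ End_k (M_i)`. -/
noncomputable def structureHom (H : AugAlg k r) : A →ₐ[k] O M H :=
  let act (a : A) : (∀ i, M i) →ₗ[Fin r → k] (∀ i, M i) :=
    { toFun := fun m i => MulOpposite.op a • m i
      map_add' := fun m n => by
        ext i
        exact smul_add _ _ _
      map_smul' := fun c m => by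
        ext i
        exact smul_comm (MulOpposite.op a) (c i) (m i) }
  let tact (a : A) : Module.End H.carrier (Tens M H) :=
    { toFun := LinearMap.lTensor H.carrier (act a)
      map_add' := map_add _
      map_smul' := fun h x => by
        induction x using TensorProduct.induction_on with
        | zero => simp
        | add x y hx hy => rw [smul_add, map_add, hx, hy, map_add, smul_add]
        | tmul b m => rfl }
  AlgHom.ofLinearMap
    { toFun := fun a => MulOpposite.op (tact a)
      map_add' := fun a b => by
        apply MulOpposite.unop_injective
        apply tens_ext
        intro m
        change (1 : H.carrier) ⊗ₜ[Fin r → k] (act (a + b) m) = (1 : H.carrier) ⊗ₜ (act a m) + (1 : H.carrier) ⊗ₜ (act b m)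
        rw [← TensorProduct.tmul_add]
        congr 1
        ext i
        exact add_smul (MulOpposite.op a) (MulOpposite.op b) (m i)
      map_smul' := fun c a => by
        apply MulOpposite.unop_injective
        apply tens_ext
        intro m
        change (1 : H.carrier) ⊗ₜ[Fin r → k] (act (c • a) m) = c • ((1 : H.carrier) ⊗ₜ[Fin r → k] (act a m))
        rw [← algebraMap_smul H.carrier c ((1 : H.carrier) ⊗ₜ[Fin r → k] (act a m)),
          show algebraMap k H.carrier c = H.ι (algebraMap k (Fin r → k) c) from
            (H.ι.commutes c).symm, ι_smul_one_tmul]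
        congr 1
        ext i
        exact smul_assoc c (MulOpposite.op a) (m i) }
    (by
      apply MulOpposite.unop_injective
      apply tens_ext
      intro m
      change (1 : H.carrier) ⊗ₜ[Fin r → k] (act 1 m) = (1 : H.carrier) ⊗ₜ m
      congr 1
      ext i
      exact one_smul Aᵐᵒᵖ (m i))
    (by
      intro a b
      apply MulOpposite.unop_injective
      apply tens_ext
      intro m
      change (1 : H.carrier) ⊗ₜ[Fin r → k] (act (a * b) m) = (1 : H.carrier) ⊗ₜ (act b (act a m))
      congr 1
      ext i
      exact mul_smul (MulOpposite.op b) (MulOpposite.op a) (m i))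

variable {A}

/-- `φ : A → End_S (S ⊗_{k^r} M)` lifts the `A`-module structure of `M`:
`Π(π_S) ∘ φ = ⊕ η_{M_i}`. -/
def IsLift {S : AugAlg k r} (φ : A →ₐ[k] O M S) : Prop :=
  (endHom M S.augHom).comp φ = structureHom M A (base k r)

variable {M}

/-- Two homomorphisms `φ, φ' : A → End_S (S ⊗_{k^r} M)` define isomorphic deformations of `M`:
they are conjugate by an `S`-linear automorphism `v` of `S ⊗_{k^r} M` that reduces to the
identity of `M`. -/
def Equivalent {S : AugAlg k r} (φ φ' : A →ₐ[k] O M S) : Prop :=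
  ∃ v : (O M S)ˣ, endHom M S.augHom (v : O M S) = 1 ∧ ∀ a, φ a * (v : O M S) = (v : O M S) * φ' a

/-- `(H, ρ)` is a pre-completion of `A` in `M = ⊕ M_i`: `H` is complete, `ρ : A → End_H (H ⊗_{k^r} M)` lifts the module
structure of `M`, every lift `φ` over a complete augmented algebra `S` is induced, up to
isomorphism of deformations, by a morphism `ψ : H → S`, and `ψ` is unique when `S` is the
tangent algebra. -/
structure IsPrecompletion (H : AugAlg k r) (ρ : A →ₐ[k] O M H) : Prop where
  complete : H.IsComplete
  isLift : IsLift M ρ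
  versal : ∀ S : AugAlg k r, S.IsComplete → ∀ φ : A →ₐ[k] O M S, IsLift M φ →
    ∃ ψ : Hom H S, Equivalent ((endHom M ψ).comp ρ) φ
  unique : ∀ φ : A →ₐ[k] O M (tangent k r), IsLift M φ →
    ∀ ψ ψ' : Hom H (tangent k r), Equivalent ((endHom M ψ).comp ρ) φ →
      Equivalent ((endHom M ψ').comp ρ) φ → ψ = ψ'

end Functions

end AugAlg

/-! By the Nullstellensatz each `A / 𝔪_i` is `k`, so `M` is free of rank one over `k^r`. Hence `H ⊗
M` is free of rank one over `H`, and its endomorphisms, acting on the right, are `H` itself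
(`endEquiv`). Through this identification, lifts become homomorphisms `A → S` over the evaluation
map `ev : A → k^r`, and isomorphism becomes conjugation by units of augmentation `1`; this is the
notion `IsVersal` (`isPrecompletion_iff`).

The product `B` of the `𝔪_i`-adic completions is versal. A lift `φ : A → S` sends `(ker ev)^n` into
the `n`-th power of the augmentation ideal of `S`. By the Chinese remainder theorem `A` is dense in
`B`, with induced topology that of the powers of `ker ev`, so `φ` extends to `B`
(`IsComplete.exists_extension`). The extension need not respect the maps from `k^r`, but a conjugate
of it does (`IsComplete.exists_hom_conj`). Uniqueness over the tangent algebra `T` holds because a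
commutative `B` can only map to diagonal matrices, where conjugation has no effect
(`Hom.tangent_eq_of_conj`).

Let `(H, σ)` be another versal pair. Versality gives `ψ : H → B` and `χ : B → H`. Commutativity and
density force `ψ ∘ χ = id`, so `ψ` is onto. The endomorphism `θ = χ ∘ ψ` preserves `σ` up to
conjugation, so uniqueness over `T` makes it the identity on `𝔪 / 𝔪²`, for morphisms to `T` separate
the points there (`mem_augIdeal_pow_two`). It is then the identity on every `𝔪^n / 𝔪^(n+1)`, hence
injective as `H` is separated (`IsVersal.injective_of_conj`). So `ψ` is an isomorphism; no
finiteness of `H` and no density of `σ` is needed. -/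

/-- A ring homomorphism that maps an ideal `J` into an ideal `I` maps `J ^ n` into `I ^ n`. -/
theorem RingHom.map_mem_ideal_pow {R S : Type*} [Ring R] [Ring S] (f : R →+* S) {J : Ideal R}
    {I : Ideal S} [J.IsTwoSided] [I.IsTwoSided] (h : ∀ a ∈ J, f a ∈ I) (n : ℕ) :
    ∀ a ∈ J ^ n, f a ∈ I ^ n := by
  induction n with
  | zero =>
    intro a _
    rw [Submodule.pow_zero, Ideal.one_eq_top]
    exact Submodule.mem_top
  | succ n ih =>
    intro a ha
    rw [Ideal.IsTwoSided.pow_succ] at ha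
    refine Submodule.mul_induction_on ha (fun x hx y hy => ?_) fun x y hx hy => ?_
    · rw [map_mul, Ideal.IsTwoSided.pow_succ]
      exact Ideal.mul_mem_mul (h x hx) (ih y hy)
    · rw [map_add]
      exact add_mem hx hy

/-! ### Units and limits in complete augmented algebras. -/

namespace AugAlg

variable {k : Type u} [Field k] {r : ℕ}

theorem mem_augIdeal {H : AugAlg k r} {x : H.carrier} : x ∈ H.augIdeal ↔ H.π x = 0 :=
  RingHom.mem_ker

instance (H : AugAlg k r) : H.augIdeal.IsTwoSided :=
  inferInstanceAs (RingHom.ker H.π).IsTwoSided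

theorem map_mem_augIdeal_pow {H S : AugAlg k r} (ψ : H.carrier →ₐ[k] S.carrier)
    (h : ∀ x, S.π (ψ x) = H.π x) {n : ℕ} {x : H.carrier} (hx : x ∈ H.augIdeal ^ n) :
    ψ x ∈ S.augIdeal ^ n :=
  ψ.toRingHom.map_mem_ideal_pow
    (fun a ha => mem_augIdeal.2 ((h a).trans (mem_augIdeal.1 ha))) n x hx

theorem pow_mem_augIdeal_pow {H : AugAlg k r} {w : H.carrier} (hw : w ∈ H.augIdeal) (n : ℕ) :
    w ^ n ∈ H.augIdeal ^ n := by
  induction n with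
  | zero =>
    rw [Submodule.pow_zero, Ideal.one_eq_top]
    exact Submodule.mem_top
  | succ n ih =>
    rw [pow_succ', Ideal.IsTwoSided.pow_succ]
    exact Ideal.mul_mem_mul hw ih

theorem IsComplete.eq_of_sub_mem {S : AugAlg k r} (hS : S.IsComplete) {x y : S.carrier}
    (h : ∀ n, x - y ∈ S.augIdeal ^ n) : x = y :=
  sub_eq_zero.1 (hS.hausdorff _ h)

/-- An element of a complete augmented algebra with augmentation `1` is invertible. -/
theorem IsComplete.isUnit {S : AugAlg k r} (hS : S.IsComplete) {v : S.carrier} (hv : S.π v = 1) :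
    IsUnit v := by
  have hw : 1 - v ∈ S.augIdeal := by rw [mem_augIdeal, map_sub, map_one, hv, sub_self]
  -- The inverse of `v` is the sum of the geometric series in `1 - v`.
  obtain ⟨L, hL⟩ := hS.precomplete (fun n => ∑ i ∈ Finset.range n, (1 - v) ^ i) fun n => by
    rw [Finset.sum_range_succ, add_sub_cancel_left]
    exact pow_mem_augIdeal_pow hw n
  refine isUnit_iff_exists.2 ⟨L, ?_, ?_⟩ <;> refine hS.eq_of_sub_mem fun n => ?_
  · have e : v * ∑ i ∈ Finset.range n, (1 - v) ^ i = 1 - (1 - v) ^ n := by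
      simpa using mul_neg_geom_sum (1 - v) n
    have : v * L - 1 = v * (L - ∑ i ∈ Finset.range n, (1 - v) ^ i) - (1 - v) ^ n := by
      rw [mul_sub, e]; abel
    rw [this]
    exact sub_mem (Ideal.mul_mem_left _ _ (hL n)) (pow_mem_augIdeal_pow hw n)
  · have e : (∑ i ∈ Finset.range n, (1 - v) ^ i) * v = 1 - (1 - v) ^ n := by
      simpa using geom_sum_mul_neg (1 - v) n
    have : L * v - 1 = (L - ∑ i ∈ Finset.range n, (1 - v) ^ i) * v - (1 - v) ^ n := by
      rw [sub_mul, e]; abel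
    rw [this]
    exact sub_mem (Ideal.mul_mem_right _ _ (hL n)) (pow_mem_augIdeal_pow hw n)

/-! ### Extension by continuity, and conjugation into morphisms. -/

section Extension

variable {A : Type*} [Ring A] [Algebra k A]

/-- An algebra homomorphism `φ : A → S` into a complete augmented algebra extends along a
homomorphism `ρ : A → B` with dense image to an algebra homomorphism `B → S`, provided that `φ`
is continuous for the topology that `ρ` induces on `A`. -/
theorem IsComplete.exists_extension {B S : AugAlg k r} (hS : S.IsComplete)
    (ρ : A →ₐ[k] B.carrier) (φ : A →ₐ[k] S.carrier)
    (dense : ∀ (x : B.carrier) (n : ℕ), ∃ a, x - ρ a ∈ B.augIdeal ^ n)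
    (cont : ∀ (n : ℕ) (a : A), ρ a ∈ B.augIdeal ^ n → φ a ∈ S.augIdeal ^ n) :
    ∃ ψ : B.carrier →ₐ[k] S.carrier, (∀ a, ψ (ρ a) = φ a) ∧
      ∀ n, ∀ x ∈ B.augIdeal ^ n, ψ x ∈ S.augIdeal ^ n := by
  -- The value at `x` is required to be close to `φ a` for every approximation `ρ a` of `x`, not
  -- only for a chosen sequence. This makes it independent of choices.
  have key : ∀ x, ∃ s : S.carrier, ∀ n a, x - ρ a ∈ B.augIdeal ^ n → s - φ a ∈ S.augIdeal ^ n := by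
    intro x
    choose a ha using dense x
    have close : ∀ n b, x - ρ b ∈ B.augIdeal ^ n → φ (a n) - φ b ∈ S.augIdeal ^ n := by
      intro n b hb
      rw [← map_sub]
      apply cont
      have := sub_mem hb (ha n)
      rwa [sub_sub_sub_cancel_left, ← map_sub] at this
    obtain ⟨L, hL⟩ := hS.precomplete (fun n => φ (a n)) fun n => by
      rw [← neg_sub]
      exact neg_mem (close n _ (Ideal.pow_le_pow_right n.le_succ (ha (n + 1))))
    refine ⟨L, fun n b hb => ?_⟩
    rw [← sub_add_sub_cancel L (φ (a n))]
    exact add_mem (hL n) (close n b hb)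
  choose ψ hψ using key
  -- One common approximant for each `n` identifies a value of `ψ`; all the ring laws below are read
  -- off from approximants in `A`.
  have eq_of : ∀ x s, (∀ n, ∃ a, x - ρ a ∈ B.augIdeal ^ n ∧ s - φ a ∈ S.augIdeal ^ n) →
      ψ x = s := by
    intro x s h
    refine hS.eq_of_sub_mem fun n => ?_
    obtain ⟨a, ha, hs⟩ := h n
    rw [← sub_sub_sub_cancel_right _ _ (φ a)]
    exact sub_mem (hψ x n a ha) hs
  have ψρ : ∀ a, ψ (ρ a) = φ a := fun a => eq_of _ _ fun n => ⟨a, by simp, by simp⟩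
  refine ⟨⟨⟨⟨⟨ψ, ?_⟩, ?_⟩, ?_, ?_⟩, ?_⟩, ψρ, ?_⟩
  · simpa using ψρ 1
  · intro x y
    refine eq_of _ _ fun n => ?_
    obtain ⟨a, ha⟩ := dense x n
    obtain ⟨b, hb⟩ := dense y n
    have split : ∀ {R : Type u} [Ring R] (x y a b : R),
        x * y - a * b = (x - a) * y + a * (y - b) := by intros; noncomm_ring
    refine ⟨a * b, ?_, ?_⟩
    · rw [map_mul, split]
      exact add_mem (Ideal.mul_mem_right _ _ ha) (Ideal.mul_mem_left _ _ hb)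
    · rw [map_mul]
      change ψ x * ψ y - _ ∈ _
      rw [split]
      exact add_mem (Ideal.mul_mem_right _ _ (hψ x n a ha)) (Ideal.mul_mem_left _ _ (hψ y n b hb))
  · simpa using ψρ 0
  · intro x y
    refine eq_of _ _ fun n => ?_
    obtain ⟨a, ha⟩ := dense x n
    obtain ⟨b, hb⟩ := dense y n
    refine ⟨a + b, ?_, ?_⟩
    · rw [map_add, add_sub_add_comm]
      exact add_mem ha hb
    · rw [map_add]
      change ψ x + ψ y - _ ∈ _
      rw [add_sub_add_comm]
      exact add_mem (hψ x n a ha) (hψ y n b hb)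
  · intro c
    simpa using ψρ (algebraMap k A c)
  · intro n x hx
    simpa using hψ x n 0 (by simpa using hx)

end Extension

/-- Algebra homomorphisms compatible with the augmentations can be conjugated into morphisms of
augmented algebras. -/
theorem IsComplete.exists_hom_conj {B S : AugAlg k r} (hS : S.IsComplete)
    (ψ : B.carrier →ₐ[k] S.carrier) (hψ : ∀ x, S.π (ψ x) = B.π x) :
    ∃ (χ : Hom B S) (v : S.carrierˣ), S.π v = 1 ∧ ∀ x, χ.toAlgHom x * v = v * ψ x := by
  let e : Fin r → (Fin r → k) := fun i => Pi.single i 1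
  -- The `S.ι (e i)` and the `ψ (B.ι (e i))` are two systems of orthogonal idempotents with the same
  -- augmentation. This `w` intertwines them: both `S.ι (e j) * w` and `w * ψ (B.ι (e j))` reduce to
  -- the `j`-th summand.
  let w : S.carrier := ∑ i, S.ι (e i) * ψ (B.ι (e i))
  have ee : ∀ i j, e i * e j = if i = j then e i else 0 := by
    intro i j
    ext l
    by_cases h : i = j
    · subst h; simp [e, Pi.single_apply]
    · simp only [e, Pi.mul_apply, Pi.single_apply, if_neg h, Pi.zero_apply]
      split_ifs <;> simp_all
  have sum_e : ∀ c : Fin r → k, c = ∑ i, c i • e i := by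
    intro c
    ext l
    simp [e, Finset.sum_apply, Pi.single_apply]
  have hw : S.π w = 1 := by
    simp only [w, map_sum, map_mul, S.π_ι, hψ, B.π_ι, ee, if_true]
    conv_rhs => rw [sum_e 1]
    simp
  have comm : ∀ c, S.ι c * w = w * ψ (B.ι c) := by
    intro c
    have h : ∀ j, S.ι (e j) * w = w * ψ (B.ι (e j)) := by
      intro j
      simp only [w, Finset.mul_sum, Finset.sum_mul, ← mul_assoc, ← map_mul]
      simp only [mul_assoc, ← map_mul, ee]
      simp [apply_ite S.ι, apply_ite B.ι, apply_ite ψ]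
    rw [sum_e c]
    simp only [map_sum, map_smul, Finset.sum_mul, Finset.mul_sum, smul_mul_assoc,
      mul_smul_comm, h]
  obtain ⟨v, hv⟩ := hS.isUnit hw
  have hv' : S.π (v⁻¹ : S.carrierˣ) = 1 := by
    have := congrArg S.π v.mul_inv
    rwa [map_mul, hv, hw, one_mul, map_one] at this
  let χ : B.carrier →ₐ[k] S.carrier := AlgHom.ofLinearMap
    { toFun := fun x => v * ψ x * (v⁻¹ : S.carrierˣ)
      map_add' := fun x y => by rw [map_add, mul_add, add_mul]
      map_smul' := fun c x => by simp }
    (by simp)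
    (by intro x y; simp [mul_assoc])
  have hχ : ∀ x, χ x = v * ψ x * (v⁻¹ : S.carrierˣ) := fun x => rfl
  refine ⟨⟨χ, ?_, ?_⟩, v, hv ▸ hw, ?_⟩
  · intro c
    rw [hχ, hv, ← comm, ← hv, Units.mul_inv_cancel_right]
  · intro x
    rw [hχ, map_mul, map_mul, hv', hv, hw, hψ, one_mul, mul_one]
  · intro x
    change χ x * v = _
    rw [hχ, Units.inv_mul_cancel_right]

/-! ### The tangent algebra and `𝔪 / 𝔪²`. -/

section Tangent

theorem augIdeal_pow_two (H : AugAlg k r) : H.augIdeal ^ 2 = H.augIdeal * H.augIdeal := by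
  rw [Ideal.IsTwoSided.pow_succ, Submodule.pow_one]

/-- All entries of a matrix in the augmentation ideal are multiples of `ε`, and `ε² = 0`. -/
theorem eq_zero_of_mem_augIdeal_tangent_pow_two {x : (tangent k r).carrier}
    (hx : x ∈ (tangent k r).augIdeal ^ 2) : x = 0 := by
  have zero : ∀ x ∈ (tangent k r).augIdeal, ∀ i j, (x.1 i j).fst = 0 := by
    intro x hx i j
    by_cases h : i = j
    · subst h; exact congrFun (mem_augIdeal.1 hx) i
    · exact x.2 i j h
  rw [augIdeal_pow_two] at hx
  refine Submodule.mul_induction_on hx (fun x hx y hy => ?_) fun x y hx hy => ?_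
  · apply Subtype.ext
    refine Matrix.ext fun i j => ?_
    change (x.1 * y.1) i j = 0
    rw [Matrix.mul_apply]
    refine Finset.sum_eq_zero fun l _ => ?_
    ext
    · simp [zero x hx, zero y hy]
    · simp [zero x hx, zero y hy]
  · rw [hx, hy, add_zero]

theorem tangent_ext {x y : (tangent k r).carrier} (h₁ : (tangent k r).π x = (tangent k r).π y)
    (h₂ : ∀ i j, (x.1 i j).snd = (y.1 i j).snd) : x = y := by
  apply Subtype.ext
  refine Matrix.ext fun i j => TrivSqZeroExt.ext ?_ (h₂ i j)
  by_cases h : i = j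
  · subst h; exact congrFun h₁ i
  · rw [x.2 i j h, y.2 i j h]

/-- The morphism `H → T` given by a linear form on `H` that satisfies the Leibniz rule at the
place `(i, j)` and vanishes on the image of `k^r`. -/
noncomputable def homTangent (H : AugAlg k r) (i j : Fin r) (g : H.carrier →ₗ[k] k)
    (g_mul : ∀ x y, g (x * y) = H.π x i * g y + g x * H.π y j) (g_ι : ∀ c, g (H.ι c) = 0) :
    Hom H (tangent k r) :=
  let F : H.carrier → (tangent k r).carrier := fun x =>
    ⟨Matrix.diagonal (fun l => TrivSqZeroExt.inl (H.π x l)) +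
        Matrix.single i j (TrivSqZeroExt.inr (g x)), by
      intro p q hpq
      rw [Matrix.add_apply, Matrix.diagonal_apply_ne _ hpq, Matrix.single_apply]
      split_ifs <;> simp⟩
  have π_F : ∀ x, (tangent k r).π (F x) = H.π x := by
    intro x
    ext l
    change ((Matrix.diagonal (fun l => TrivSqZeroExt.inl (H.π x l)) +
        Matrix.single i j (TrivSqZeroExt.inr (g x)) : Matrix _ _ (DualNumber k)) l l).fst = _
    rw [Matrix.add_apply, Matrix.diagonal_apply_eq, Matrix.single_apply]
    split_ifs <;> simp
  have snd_F : ∀ x p q, ((F x).1 p q).snd = if i = p ∧ j = q then g x else 0 := by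
    intro x p q
    change ((Matrix.diagonal (fun l => TrivSqZeroExt.inl (H.π x l)) +
        Matrix.single i j (TrivSqZeroExt.inr (g x)) : Matrix _ _ (DualNumber k)) p q).snd = _
    rw [Matrix.add_apply, Matrix.single_apply, Matrix.diagonal_apply]
    split_ifs <;> simp
  have fst_F : ∀ x p q, ((F x).1 p q).fst = if p = q then H.π x p else 0 := by
    intro x p q
    split_ifs with h
    · subst h; exact congrFun (π_F x) p
    · exact (F x).2 p q h
  have F_ι : ∀ c, F (H.ι c) = (tangent k r).ι c := by
    intro c
    refine tangent_ext (by rw [π_F, H.π_ι, (tangent k r).π_ι]) fun p q => ?_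
    rw [snd_F, g_ι]
    change _ = ((Matrix.diagonal fun i => (TrivSqZeroExt.inl (c i) : DualNumber k)) p q).snd
    rw [Matrix.diagonal_apply]
    split_ifs <;> simp
  { toAlgHom := AlgHom.ofLinearMap
      { toFun := F
        map_add' := fun x y => by
          refine tangent_ext (by rw [π_F, map_add, map_add, π_F, π_F]) fun p q => ?_
          change _ = ((F x).1 p q + (F y).1 p q).snd
          rw [TrivSqZeroExt.snd_add, snd_F, snd_F, snd_F, map_add]
          split_ifs <;> simp
        map_smul' := fun c x => by
          refine tangent_ext (by rw [π_F, map_smul, RingHom.id_apply, map_smul, π_F]) fun p q => ?_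
          change _ = (c • (F x).1 p q).snd
          rw [TrivSqZeroExt.snd_smul, snd_F, snd_F, map_smul]
          split_ifs <;> simp }
      (by
        change F 1 = 1
        rw [← map_one H.ι, F_ι, map_one])
      (by
        intro x y
        change F (x * y) = F x * F y
        refine tangent_ext (by rw [π_F, map_mul, map_mul, π_F, π_F]) fun p q => ?_
        change _ = (((F x).1 * (F y).1) p q).snd
        rw [Matrix.mul_apply, TrivSqZeroExt.snd_sum]
        simp only [TrivSqZeroExt.snd_mul, fst_F, snd_F, g_mul, Finset.sum_add_distrib]
        simp only [smul_eq_mul, ite_mul, zero_mul, mul_ite, mul_zero, op_smul_eq_mul,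
          Finset.sum_ite_eq', Finset.mem_univ, if_true]
        split_ifs with h
        · obtain ⟨rfl, rfl⟩ := h
          simp
        · rw [add_zero]
          refine (Finset.sum_eq_zero fun l _ => ?_).symm
          split_ifs <;> simp_all)
    map_ι := F_ι
    map_π := π_F }

theorem homTangent_snd (H : AugAlg k r) (i j : Fin r) (g : H.carrier →ₗ[k] k)
    (g_mul : ∀ x y, g (x * y) = H.π x i * g y + g x * H.π y j) (g_ι : ∀ c, g (H.ι c) = 0)
    (x : H.carrier) : (((homTangent H i j g g_mul g_ι).toAlgHom x).1 i j).snd = g x := by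
  change ((Matrix.diagonal (fun l => TrivSqZeroExt.inl (H.π x l)) +
        Matrix.single i j (TrivSqZeroExt.inr (g x)) : Matrix _ _ (DualNumber k)) i j).snd = _
  rw [Matrix.add_apply, Matrix.single_apply_same, Matrix.diagonal_apply]
  split_ifs <;> simp

/-- Morphisms to the tangent algebra separate the points of `𝔪 / 𝔪 ^ 2`. -/
theorem mem_augIdeal_pow_two {H : AugAlg k r} {y : H.carrier}
    (h : ∀ χ : Hom H (tangent k r), χ.toAlgHom y = 0) : y ∈ H.augIdeal ^ 2 := by
  by_contra hy
  have sum_e : (1 : Fin r → k) = ∑ i, Pi.single i 1 := by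
    ext l
    simp [Finset.sum_apply, Pi.single_apply]
  -- Peirce decomposition: `y` is the sum of its components between the idempotents of `k^r`, so one
  -- of them lies outside `𝔪²`.
  obtain ⟨i, j, hij⟩ : ∃ i j : Fin r,
      H.ι (Pi.single i 1) * y * H.ι (Pi.single j 1) ∉ H.augIdeal ^ 2 := by
    by_contra hall
    push Not at hall
    apply hy
    have : y = ∑ i, ∑ j, H.ι (Pi.single i 1) * y * H.ι (Pi.single j 1) := by
      simp_rw [← Finset.mul_sum, ← Finset.sum_mul, ← map_sum, ← sum_e]
      simp
    rw [this]
    exact sum_mem fun i _ => sum_mem fun j _ => hall i j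
  obtain ⟨f, hf, hf₀⟩ := Submodule.exists_le_ker_of_notMem
    (p := (H.augIdeal ^ 2).restrictScalars k) hij
  have f_sq : ∀ x ∈ H.augIdeal ^ 2, f x = 0 := fun x hx => hf₀ hx
  -- Projecting to `𝔪` along the image of `k^r` and then to the place `(i, j)` before applying `f`
  -- makes `g` vanish on `k^r`; the Leibniz rule holds because `f` kills `𝔪²`.
  let g : H.carrier →ₗ[k] k := f ∘ₗ LinearMap.mulLeftRight k
      (H.ι (Pi.single i 1), H.ι (Pi.single j 1)) ∘ₗ
    (LinearMap.id - H.ι.toLinearMap ∘ₗ H.π.toLinearMap)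
  have g_apply : ∀ x, g x = f (H.ι (Pi.single i 1) * (x - H.ι (H.π x)) * H.ι (Pi.single j 1)) :=
    fun x => rfl
  have sub_mem' : ∀ x, x - H.ι (H.π x) ∈ H.augIdeal := fun x => by
    rw [mem_augIdeal, map_sub, H.π_ι, sub_self]
  have single_mul : ∀ (i : Fin r) (c : Fin r → k),
      Pi.single i 1 * c = c i • (Pi.single i 1 : Fin r → k) := by
    intro i c
    ext l
    by_cases hl : l = i
    · subst hl; simp
    · simp [hl]
  have g_ι : ∀ c, g (H.ι c) = 0 := by
    intro c
    rw [g_apply, H.π_ι, sub_self, mul_zero, zero_mul, map_zero]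
  have g_mul : ∀ x y, g (x * y) = H.π x i * g y + g x * H.π y j := by
    intro x y
    -- Write `x = x₀ + x'` and `y = y₀ + y'` with `x₀`, `y₀` from `k^r`: then `x y - x₀ y₀ = x₀ y' +
    -- x' y₀ + x' y'`. The outer idempotents turn `x₀` and `y₀` into the scalars `π x i` and `π y
    -- j`, and the last term is in `𝔪²`.
    have e : H.ι (Pi.single i 1) * (x * y - H.ι (H.π (x * y))) * H.ι (Pi.single j 1) =
        H.π x i • (H.ι (Pi.single i 1) * (y - H.ι (H.π y)) * H.ι (Pi.single j 1)) +
        H.π y j • (H.ι (Pi.single i 1) * (x - H.ι (H.π x)) * H.ι (Pi.single j 1)) +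
        H.ι (Pi.single i 1) * ((x - H.ι (H.π x)) * (y - H.ι (H.π y))) * H.ι (Pi.single j 1) := by
      rw [← smul_mul_assoc, ← smul_mul_assoc, ← map_smul, ← single_mul, ← mul_smul_comm,
        ← map_smul, ← single_mul, mul_comm (Pi.single j 1) (H.π y), map_mul, map_mul, map_mul,
        map_mul]
      noncomm_ring
    rw [g_apply, e, map_add, map_add, map_smul, map_smul, ← g_apply, ← g_apply,
      f_sq _ (Ideal.mul_mem_right _ _ (Ideal.mul_mem_left _ _ ?_)), add_zero, smul_eq_mul,
      smul_eq_mul, mul_comm (g x)]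
    rw [augIdeal_pow_two]
    exact Ideal.mul_mem_mul (sub_mem' x) (sub_mem' y)
  have hy₀ : H.π y = 0 := by
    by_contra hne
    obtain ⟨l, hl⟩ := Function.ne_iff.1 hne
    -- The zero form gives a morphism to `T` that already detects the augmentation of `y`.
    have := (homTangent H l l 0 (by simp) (by simp)).map_π y
    rw [h, map_zero] at this
    exact hne this.symm
  have := homTangent_snd H i j g g_mul g_ι y
  rw [h, g_apply, hy₀, map_zero, sub_zero] at this
  exact hf this.symm

end Tangent

end AugAlg

/-! ### Versal homomorphisms and their uniqueness. -/

namespace AugAlg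

section Versal

variable {k : Type u} [Field k] {r : ℕ} {A : Type u} [Ring A] [Algebra k A]

/-- The defining properties of a pre-completion of `A` at the points `ev : A → k^r`, for
homomorphisms to the augmented algebras themselves in place of endomorphism algebras. -/
structure IsVersal (ev : A →ₐ[k] (Fin r → k)) (H : AugAlg k r) (ρ : A →ₐ[k] H.carrier) :
    Prop where
  complete : H.IsComplete
  isLift : ∀ a, H.π (ρ a) = ev a
  versal : ∀ S : AugAlg k r, S.IsComplete → ∀ φ : A →ₐ[k] S.carrier, (∀ a, S.π (φ a) = ev a) →
    ∃ (ψ : Hom H S) (v : S.carrierˣ), S.π v = 1 ∧ ∀ a, ψ.toAlgHom (ρ a) * v = v * φ a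
  unique : ∀ φ : A →ₐ[k] (tangent k r).carrier, (∀ a, (tangent k r).π (φ a) = ev a) →
    ∀ ψ ψ' : Hom H (tangent k r),
      (∃ v : (tangent k r).carrierˣ, (tangent k r).π v = 1 ∧
        ∀ a, ψ.toAlgHom (ρ a) * v = v * φ a) →
      (∃ v : (tangent k r).carrierˣ, (tangent k r).π v = 1 ∧
        ∀ a, ψ'.toAlgHom (ρ a) * v = v * φ a) → ψ = ψ'

variable {ev : A →ₐ[k] (Fin r → k)} {B : AugAlg k r} {ρ : A →ₐ[k] B.carrier}

/-- A morphism from a commutative augmented algebra to the tangent algebra takes values in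
diagonal matrices. -/
theorem Hom.tangent_apply_ne (comm : ∀ x y : B.carrier, x * y = y * x) (ψ : Hom B (tangent k r))
    (x : B.carrier) {i j : Fin r} (hij : i ≠ j) : (ψ.toAlgHom x).1 i j = 0 := by
  -- The image of `x` commutes with the `i`-th diagonal idempotent. In the `(i, j)` entry,
  -- multiplying by it on the left keeps the entry and on the right kills it.
  have h := congrArg ψ.toAlgHom (comm (B.ι (Pi.single i 1)) x)
  rw [map_mul, map_mul, ψ.map_ι] at h
  have h' : ((Matrix.diagonal fun l => (TrivSqZeroExt.inl ((Pi.single i 1 : Fin r → k) l) :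
      DualNumber k)) * (ψ.toAlgHom x).1) i j = ((ψ.toAlgHom x).1 * Matrix.diagonal fun l =>
        (TrivSqZeroExt.inl ((Pi.single i 1 : Fin r → k) l) : DualNumber k)) i j :=
    congrFun (congrFun (congrArg Subtype.val h) i) j
  rw [Matrix.diagonal_mul, Matrix.mul_diagonal] at h'
  simpa [hij.symm] using h'

/-- Isomorphic lifts that are induced by morphisms from a commutative augmented algebra to the
tangent algebra are equal. -/
theorem Hom.tangent_eq_of_conj (comm : ∀ x y : B.carrier, x * y = y * x)
    (ψ ψ' : Hom B (tangent k r)) {v : (tangent k r).carrier} (hv : (tangent k r).π v = 1)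
    {x : B.carrier} (h : ψ.toAlgHom x * v = v * ψ'.toAlgHom x) :
    ψ.toAlgHom x = ψ'.toAlgHom x := by
  apply Subtype.ext
  refine Matrix.ext fun i j => ?_
  by_cases hij : i = j
  · subst hij
    have h' : ((ψ.toAlgHom x).1 * v.1) i i = (v.1 * (ψ'.toAlgHom x).1) i i :=
      congrFun (congrFun (congrArg Subtype.val h) i) i
    -- Only the diagonal terms survive, so the equation lives in the commutative ring of dual
    -- numbers, where the unit `v_ii` cancels.
    rw [Matrix.mul_apply, Matrix.mul_apply, Finset.sum_eq_single i, Finset.sum_eq_single i,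
      mul_comm] at h'
    · have hu : IsUnit (v.1 i i) := by
        rw [TrivSqZeroExt.isUnit_iff_isUnit_fst, show (v.1 i i).fst = 1 from congrFun hv i]
        exact isUnit_one
      exact hu.mul_left_cancel h'
    · intro l _ hl
      rw [Hom.tangent_apply_ne comm ψ' x hl, mul_zero]
    · intro hi; exact absurd (Finset.mem_univ i) hi
    · intro l _ hl
      rw [Hom.tangent_apply_ne comm ψ x hl.symm, zero_mul]
    · intro hi; exact absurd (Finset.mem_univ i) hi
  · rw [Hom.tangent_apply_ne comm ψ x hij, Hom.tangent_apply_ne comm ψ' x hij]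

/-- Density and `cont` let every lift extend continuously to `B`, because a lift carries powers of
`ker ev` into powers of the augmentation ideal. Commutativity serves only for uniqueness over `T`.
-/
theorem isVersal_of_dense (complete : B.IsComplete) (comm : ∀ x y : B.carrier, x * y = y * x)
    (isLift : ∀ a, B.π (ρ a) = ev a)
    (dense : ∀ (x : B.carrier) (n : ℕ), ∃ a, x - ρ a ∈ B.augIdeal ^ n)
    (cont : ∀ (n : ℕ) (a : A), ρ a ∈ B.augIdeal ^ n → a ∈ RingHom.ker ev ^ n) :
    IsVersal ev B ρ where
  complete := complete
  isLift := isLift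
  versal S hS φ hφ := by
    obtain ⟨ψ, hψ, hψ'⟩ := hS.exists_extension ρ φ dense fun n a ha =>
      φ.toRingHom.map_mem_ideal_pow
        (fun b hb => mem_augIdeal.2 ((hφ b).trans (RingHom.mem_ker.1 hb))) n a (cont n a ha)
    have π_ψ : ∀ x, S.π (ψ x) = B.π x := by
      intro x
      obtain ⟨a, ha⟩ := dense x 1
      have h := hψ' 1 _ ha
      rw [Submodule.pow_one, mem_augIdeal, map_sub, sub_eq_zero] at ha
      rw [Submodule.pow_one, mem_augIdeal, map_sub, map_sub, sub_eq_zero, hψ, hφ] at h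
      rw [h, ha, isLift]
    obtain ⟨χ, v, hv, hχ⟩ := hS.exists_hom_conj ψ π_ψ
    exact ⟨χ, v, hv, fun a => by rw [hχ, hψ]⟩
  unique φ hφ ψ ψ' := by
    rintro ⟨v, hv, h⟩ ⟨w, hw, h'⟩
    have agree : ∀ a, ψ.toAlgHom (ρ a) = ψ'.toAlgHom (ρ a) := by
      intro a
      -- Both are conjugate to `φ`, by `v` and by `w`, so `v * w⁻¹` conjugates one into the other.
      refine Hom.tangent_eq_of_conj comm ψ ψ' (v := v * (w⁻¹ : (tangent k r).carrierˣ)) ?_ ?_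
      · have := congrArg (tangent k r).π w.mul_inv
        rw [map_mul, hw, one_mul, map_one] at this
        rw [map_mul, hv, this, one_mul]
      · rw [← mul_assoc, h, mul_assoc, mul_assoc]
        congr 1
        rw [Units.eq_inv_mul_iff_mul_eq, ← mul_assoc, ← h', Units.mul_inv_cancel_right]
    apply Hom.ext
    apply AlgHom.ext
    intro x
    -- Approximation modulo `𝔪²` suffices, since the square of the augmentation ideal of `T` is
    -- zero.
    obtain ⟨a, ha⟩ := dense x 2
    have h₁ := eq_zero_of_mem_augIdeal_tangent_pow_two
      (map_mem_augIdeal_pow ψ.toAlgHom ψ.map_π ha)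
    have h₂ := eq_zero_of_mem_augIdeal_tangent_pow_two
      (map_mem_augIdeal_pow ψ'.toAlgHom ψ'.map_π ha)
    rw [map_sub, sub_eq_zero] at h₁ h₂
    rw [h₁, h₂, agree]

/-- A morphism `θ : H → H` that fixes the universal lift up to isomorphism is injective. -/
theorem IsVersal.injective_of_conj {H : AugAlg k r} {σ : A →ₐ[k] H.carrier}
    (hH : IsVersal ev H σ) (θ : Hom H H) {v : H.carrierˣ} (hv : H.π v = 1)
    (hθ : ∀ a, θ.toAlgHom (σ a) * v = v * σ a) : Function.Injective θ.toAlgHom := by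
  have step₁ : ∀ x ∈ H.augIdeal, θ.toAlgHom x - x ∈ H.augIdeal ^ 2 := by
    intro x _
    refine mem_augIdeal_pow_two fun χ => ?_
    -- Both `χ ∘ θ` and `χ` induce the lift `χ ∘ σ` up to isomorphism, by the units `χ v` and `1`,
    -- so they coincide.
    have h : (⟨χ.toAlgHom.comp θ.toAlgHom, fun c => by simp [θ.map_ι, χ.map_ι],
        fun x => by simp [θ.map_π, χ.map_π]⟩ : Hom H (tangent k r)) = χ := by
      refine hH.unique (χ.toAlgHom.comp σ) (fun a => ?_) _ _
        ⟨Units.map (χ.toAlgHom : H.carrier →* (tangent k r).carrier) v, ?_, fun a => ?_⟩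
        ⟨1, ?_, fun a => ?_⟩
      · rw [AlgHom.comp_apply, χ.map_π, hH.isLift]
      · exact (χ.map_π v).trans hv
      · change χ.toAlgHom (θ.toAlgHom (σ a)) * χ.toAlgHom v = χ.toAlgHom v * χ.toAlgHom (σ a)
        rw [← map_mul, hθ, map_mul]
      · exact map_one _
      · simp
    rw [map_sub, sub_eq_zero]
    exact congrArg (fun f : Hom H (tangent k r) => f.toAlgHom x) h
  have step : ∀ n, ∀ x ∈ H.augIdeal ^ (n + 1), θ.toAlgHom x - x ∈ H.augIdeal ^ (n + 2) := by
    intro n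
    induction n with
    | zero =>
      intro x hx
      rw [zero_add, Submodule.pow_one] at hx
      exact step₁ x hx
    | succ n ih =>
      intro x hx
      rw [Ideal.IsTwoSided.pow_succ] at hx
      refine Submodule.mul_induction_on hx (fun x hx y hy => ?_) fun x y hx hy => ?_
      -- The map `θ - id` is a twisted derivation, so the gain of one power of `𝔪` passes from `𝔪`
      -- to all its powers.
      · have : θ.toAlgHom (x * y) - x * y =
            (θ.toAlgHom x - x) * θ.toAlgHom y + x * (θ.toAlgHom y - y) := by
          rw [map_mul]; noncomm_ring
        rw [this]
        refine add_mem ?_ ?_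
        · rw [show n + 1 + 2 = 2 + (n + 1) by ring, Ideal.IsTwoSided.pow_add]
          exact Ideal.mul_mem_mul (step₁ x hx) (map_mem_augIdeal_pow _ θ.map_π hy)
        · rw [Ideal.IsTwoSided.pow_succ]
          exact Ideal.mul_mem_mul hx (ih y hy)
      · rw [map_add, add_sub_add_comm]
        exact add_mem hx hy
  rw [injective_iff_map_eq_zero]
  intro x hx
  -- On the kernel of `θ` one has `x = -(θ x - x)`, so membership in one power of `𝔪` gives
  -- membership in the next.
  have mem : ∀ n, x ∈ H.augIdeal ^ (n + 1) := by
    intro n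
    induction n with
    | zero => rw [zero_add, Submodule.pow_one, mem_augIdeal, ← θ.map_π, hx, map_zero]
    | succ n ih =>
      have := step n x ih
      rwa [hx, zero_sub, neg_mem_iff] at this
  exact hH.complete.hausdorff x fun n => Ideal.pow_le_pow_right n.le_succ (mem n)

/-- Every other pre-completion is isomorphic to a commutative pre-completion in which the image
of `A` is dense. -/
theorem IsVersal.exists_algEquiv (hB : IsVersal ev B ρ) (comm : ∀ x y : B.carrier, x * y = y * x)
    (dense : ∀ (x : B.carrier) (n : ℕ), ∃ a, x - ρ a ∈ B.augIdeal ^ n)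
    {H : AugAlg k r} {σ : A →ₐ[k] H.carrier} (hH : IsVersal ev H σ) :
    ∃ e : H.carrier ≃ₐ[k] B.carrier, ∀ a, e (σ a) = ρ a := by
  obtain ⟨ψ, u, hu, hψ⟩ := hH.versal B hB.complete ρ hB.isLift
  have hψ' : ∀ a, ψ.toAlgHom (σ a) = ρ a := fun a => by
    have := hψ a
    rwa [comm (u : B.carrier), Units.mul_left_inj] at this
  obtain ⟨χ, v, hv, hχ⟩ := hB.versal H hH.complete σ hH.isLift
  let θ : Hom H H := ⟨χ.toAlgHom.comp ψ.toAlgHom, fun c => by simp [ψ.map_ι, χ.map_ι],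
        fun x => by simp [ψ.map_π, χ.map_π]⟩
  have θ_inj : Function.Injective θ.toAlgHom := hH.injective_of_conj θ hv fun a => by
    rw [← hχ, ← hψ']; rfl
  have inj : Function.Injective ψ.toAlgHom := by
    intro x y hxy
    exact θ_inj (congrArg χ.toAlgHom hxy)
  have ψχ : ∀ x, ψ.toAlgHom (χ.toAlgHom x) = x := by
    have hρ : ∀ a, ψ.toAlgHom (χ.toAlgHom (ρ a)) = ρ a := by
      intro a
      have := congrArg ψ.toAlgHom (hχ a)
      rw [map_mul, map_mul, comm (ψ.toAlgHom v), hψ'] at this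
      exact (v.isUnit.map ψ.toAlgHom).mul_right_cancel this
    intro x
    refine hB.complete.eq_of_sub_mem fun n => ?_
    obtain ⟨a, ha⟩ := dense x n
    have h := map_mem_augIdeal_pow ψ.toAlgHom ψ.map_π
      (map_mem_augIdeal_pow χ.toAlgHom χ.map_π ha)
    rw [map_sub, map_sub, hρ] at h
    rw [← sub_sub_sub_cancel_right _ _ (ρ a)]
    exact sub_mem h ha
  exact ⟨AlgEquiv.ofBijective ψ.toAlgHom ⟨inj, fun x => ⟨_, ψχ x⟩⟩, hψ'⟩

end Versal

/-! ### Reduction from endomorphism algebras to the augmented algebras. -/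

section Coordinates

variable {k : Type u} [Field k] {r : ℕ}
variable {M : Fin r → Type u} [∀ i, AddCommGroup (M i)] [∀ i, Module k (M i)]
variable (b : (∀ i, M i) ≃ₗ[Fin r → k] (Fin r → k))

/-- The isomorphism `H ⊗_{k^r} M → H` given by a generator of the free `k^r`-module `M`. -/
noncomputable def tensEquiv (H : AugAlg k r) : Tens M H ≃ₗ[H.carrier] H.carrier :=
  let τ := (TensorProduct.congr (LinearEquiv.refl (Fin r → k) H.carrier) b).trans
    (TensorProduct.rid (Fin r → k) H.carrier)
  { τ with
    map_smul' := by
      intro h x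
      induction x using TensorProduct.induction_on with
      | zero => simp
      | add x y hx hy =>
        change τ (h • (x + y)) = h * τ (x + y)
        rw [smul_add, map_add, map_add, mul_add]
        exact congrArg₂ (· + ·) hx hy
      | tmul a m => exact mul_assoc h a (H.ι (b m)) }

theorem tensEquiv_tmul (H : AugAlg k r) (h : H.carrier) (m : ∀ i, M i) :
    tensEquiv b H (h ⊗ₜ m) = h * H.ι (b m) := rfl

theorem tensEquiv_symm_one (H : AugAlg k r) :
    (tensEquiv b H).symm 1 = 1 ⊗ₜ b.symm 1 := by
  rw [LinearEquiv.symm_apply_eq, tensEquiv_tmul]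
  simp

theorem tensEquiv_tensMap {H S : AugAlg k r} (ψ : Hom H S) (x : Tens M H) :
    tensEquiv b S (tensMap M ψ x) = ψ.toAlgHom (tensEquiv b H x) := by
  induction x using TensorProduct.induction_on with
  | zero => simp
  | add x y hx hy => simp only [map_add, hx, hy]
  | tmul a m => rw [tensMap_tmul, tensEquiv_tmul, tensEquiv_tmul, map_mul, ψ.map_ι]

/-- The isomorphism `End_H (H ⊗_{k^r} M) ≃ H` given by a generator of the free `k^r`-module
`M`. -/
noncomputable def endEquiv (H : AugAlg k r) : O M H ≃ₐ[k] H.carrier :=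
  AlgEquiv.ofLinearEquiv
    { toFun := fun f => tensEquiv b H (f.unop ((tensEquiv b H).symm 1))
      -- The endomorphism for `h` is right multiplication by `h`; with endomorphisms composed from
      -- left to right, the order of products is preserved.
      invFun := fun h => MulOpposite.op <| (tensEquiv b H).symm.toLinearMap ∘ₗ
        LinearMap.toSpanSingleton H.carrier H.carrier h ∘ₗ (tensEquiv b H).toLinearMap
      map_add' := fun f g => by simp
      map_smul' := fun c f => by
        simp only [MulOpposite.unop_smul, LinearMap.smul_apply, RingHom.id_apply]
        rw [← algebraMap_smul H.carrier c, map_smul, algebraMap_smul]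
      left_inv := fun f => by
        apply MulOpposite.unop_injective
        refine LinearMap.ext fun x => ?_
        change (tensEquiv b H).symm (tensEquiv b H x • _) = _
        rw [map_smul, LinearEquiv.symm_apply_apply, ← map_smul, ← map_smul, smul_eq_mul, mul_one,
          LinearEquiv.symm_apply_apply]
      right_inv := fun h => by simp }
    (by simp)
    (by
      intro f g
      change tensEquiv b H (g.unop (f.unop ((tensEquiv b H).symm 1))) =
        tensEquiv b H (f.unop ((tensEquiv b H).symm 1)) *
          tensEquiv b H (g.unop ((tensEquiv b H).symm 1))
      rw [← smul_eq_mul, ← map_smul, ← map_smul, ← map_smul, smul_eq_mul, mul_one,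
        LinearEquiv.symm_apply_apply])

theorem endEquiv_apply (H : AugAlg k r) (f : O M H) :
    endEquiv b H f = tensEquiv b H (f.unop (1 ⊗ₜ b.symm 1)) := by
  rw [← tensEquiv_symm_one]; rfl

/-- The generator `1 ⊗ b⁻¹(1)` is preserved by base change, so `Π(ψ)` becomes `ψ` itself. This
naturality carries every condition on lifts over to `S`. -/
theorem endEquiv_endHom {H S : AugAlg k r} (ψ : Hom H S) (f : O M H) :
    endEquiv b S (endHom M ψ f) = ψ.toAlgHom (endEquiv b H f) := by
  rw [endEquiv_apply, endEquiv_apply, ← tensEquiv_tensMap]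
  change tensEquiv b S (baseChangeEnd ψ f.unop (1 ⊗ₜ b.symm 1)) = _
  rw [baseChangeEnd_tmul, one_smul]

variable {A : Type u} [Ring A] [Algebra k A]

theorem equivalent_iff {S : AugAlg k r} (φ φ' : A →ₐ[k] O M S) :
    Equivalent φ φ' ↔ ∃ v : S.carrierˣ, S.π v = 1 ∧
      ∀ a, endEquiv b S (φ a) * v = v * endEquiv b S (φ' a) := by
  have h : ∀ v, S.π (endEquiv b S v) = endEquiv b (base k r) (endHom M S.augHom v) :=
    fun v => (endEquiv_endHom b S.augHom v).symm
  constructor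
  · rintro ⟨v, hv, hφ⟩
    refine ⟨Units.mapEquiv (endEquiv b S).toMulEquiv v, ?_, fun a => ?_⟩
    · change S.π (endEquiv b S v) = 1
      rw [h, hv, map_one]; rfl
    · change _ * endEquiv b S v = endEquiv b S v * _
      rw [← map_mul, hφ, map_mul]
  · rintro ⟨v, hv, hφ⟩
    obtain ⟨w, rfl⟩ := (Units.mapEquiv (endEquiv b S).toMulEquiv).surjective v
    refine ⟨w, (endEquiv b (base k r)).injective ?_, fun a => (endEquiv b S).injective ?_⟩
    · rw [← h, map_one]; exact hv
    · rw [map_mul, map_mul]; exact hφ a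

variable [∀ i, Module Aᵐᵒᵖ (M i)] [∀ i, IsScalarTower k Aᵐᵒᵖ (M i)]

/-- The action of `A` on a generator of the free `k^r`-module `M`. -/
noncomputable def evalHom : A →ₐ[k] (Fin r → k) :=
  ((endEquiv b (base k r)).toAlgHom).comp (structureHom M A (base k r))

theorem evalHom_apply (a : A) : evalHom b a = b fun i => MulOpposite.op a • b.symm 1 i := by
  change endEquiv b (base k r) (structureHom M A (base k r) a) = _
  rw [endEquiv_apply]
  change tensEquiv b (base k r) (1 ⊗ₜ fun i => MulOpposite.op a • b.symm 1 i) = _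
  rw [tensEquiv_tmul]
  exact one_mul _

theorem isLift_iff {S : AugAlg k r} (φ : A →ₐ[k] O M S) :
    IsLift M φ ↔ ∀ a, S.π (endEquiv b S (φ a)) = evalHom b a := by
  have h : ∀ a, S.π (endEquiv b S (φ a)) = endEquiv b (base k r) (endHom M S.augHom (φ a)) :=
    fun a => (endEquiv_endHom b S.augHom (φ a)).symm
  simp only [h]
  refine ⟨fun hφ a => ?_, fun hφ => AlgHom.ext fun a => (endEquiv b (base k r)).injective (hφ a)⟩
  rw [← AlgHom.comp_apply, show _ = _ from hφ]
  rfl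

theorem isPrecompletion_iff (H : AugAlg k r) (ρ : A →ₐ[k] O M H) :
    IsPrecompletion H ρ ↔ IsVersal (evalHom b) H ((endEquiv b H).toAlgHom.comp ρ) := by
  have key : ∀ {S : AugAlg k r} (ψ : Hom H S) (φ : A →ₐ[k] O M S),
      Equivalent ((endHom M ψ).comp ρ) φ ↔ ∃ v : S.carrierˣ, S.π v = 1 ∧
        ∀ a, ψ.toAlgHom (((endEquiv b H).toAlgHom.comp ρ) a) * v =
          v * ((endEquiv b S).toAlgHom.comp φ) a := by
    intro S ψ φ
    rw [equivalent_iff b]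
    simp only [AlgHom.comp_apply, endEquiv_endHom]
    rfl
  have surj : ∀ (S : AugAlg k r) (φ : A →ₐ[k] S.carrier),
      ∃ φ' : A →ₐ[k] O M S, φ = (endEquiv b S).toAlgHom.comp φ' :=
    fun S φ => ⟨(endEquiv b S).symm.toAlgHom.comp φ,
      AlgHom.ext fun a => ((endEquiv b S).apply_symm_apply (φ a)).symm⟩
  constructor
  · rintro ⟨h₁, h₂, h₃, h₄⟩
    refine ⟨h₁, (isLift_iff b ρ).1 h₂, fun S hS φ hφ => ?_, fun φ hφ ψ ψ' h h' => ?_⟩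
    · obtain ⟨φ, rfl⟩ := surj S φ
      obtain ⟨ψ, hψ⟩ := h₃ S hS _ ((isLift_iff b _).2 hφ)
      exact ⟨ψ, (key ψ _).1 hψ⟩
    · obtain ⟨φ, rfl⟩ := surj _ φ
      exact h₄ _ ((isLift_iff b _).2 hφ) ψ ψ' ((key ψ _).2 h) ((key ψ' _).2 h')
  · rintro ⟨h₁, h₂, h₃, h₄⟩
    refine ⟨h₁, (isLift_iff b ρ).2 h₂, fun S hS φ hφ => ?_, fun φ hφ ψ ψ' h h' => ?_⟩
    · obtain ⟨ψ, hψ⟩ := h₃ S hS ((endEquiv b S).toAlgHom.comp φ) ((isLift_iff b _).1 hφ)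
      exact ⟨ψ, (key ψ _).2 hψ⟩
    · exact h₄ ((endEquiv b _).toAlgHom.comp φ) ((isLift_iff b _).1 hφ) ψ ψ' ((key ψ _).1 h) ((key ψ' _).1 h')

end Coordinates

end AugAlg

/-! ### Powers of ideals in adic completions and in products. -/

namespace AdicCompletion

variable {A : Type*} [CommRing A]

/-- Finite generation makes the kernel of the projection to level `n` the submodule generated by `I
^ n`; the rest identifies `A / (I ^ n • ⊤)` with `A / I ^ n`. -/
theorem evalₐ_eq_zero_iff {I : Ideal A} (hI : I.FG) (n : ℕ) (x : AdicCompletion I A) :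
    evalₐ I n x = 0 ↔ x ∈ (I ^ n • ⊤ : Submodule A (AdicCompletion I A)) := by
  have h : I ^ n • (⊤ : Ideal A) = I ^ n := by simp
  rw [pow_smul_top_eq_ker_eval hI, LinearMap.mem_ker]
  constructor <;> intro hx
  · rw [← factor_evalₐ_eq_eval I x h.ge, hx]
    exact RingHom.map_zero _
  · rw [← factor_eval_eq_evalₐ I x h.le, hx]
    exact LinearMap.map_zero _

theorem evalOneₐ_eq_zero_iff {I : Ideal A} (hI : I.FG) (x : AdicCompletion I A) :
    evalOneₐ I x = 0 ↔ x ∈ I.map (algebraMap A (AdicCompletion I A)) := by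
  rw [← ker_evalOneₐ_eq_map I hI]; rfl

theorem mem_map_pow_iff {I : Ideal A} (hI : I.FG) (n : ℕ) (x : AdicCompletion I A) :
    x ∈ I.map (algebraMap A (AdicCompletion I A)) ^ n ↔ evalₐ I n x = 0 := by
  rw [evalₐ_eq_zero_iff hI, ← Ideal.map_pow, Ideal.smul_top_eq_map]
  rfl

end AdicCompletion

namespace Ideal

/-- The powers of a finite product of ideals are computed componentwise. -/
theorem mem_pow_of_forall_apply_mem_pow {ι : Type*} [Fintype ι] [DecidableEq ι] {R : ι → Type*}
    [∀ i, CommRing (R i)] {I : ∀ i, Ideal (R i)} {J : Ideal (∀ i, R i)}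
    (h : ∀ i, ∀ y ∈ I i, Pi.single i y ∈ J) {n : ℕ} {x : ∀ i, R i}
    (hx : ∀ i, x i ∈ I i ^ n) : x ∈ J ^ n := by
  have single : ∀ i n, ∀ y ∈ I i ^ n, Pi.single i y ∈ J ^ n := by
    intro i n
    induction n with
    | zero => simp
    | succ n ih =>
      intro y hy
      rw [pow_succ] at hy
      refine Submodule.mul_induction_on hy (fun y hy z hz => ?_) fun y z hy hz => ?_
      · rw [Pi.single_mul, pow_succ]
        exact Ideal.mul_mem_mul (ih y hy) (h i z hz)
      · rw [Pi.single_add]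
        exact add_mem hy hz
  rw [← Finset.univ_sum_single x]
  exact Submodule.sum_mem _ fun i _ => single i n _ (hx i)

end Ideal

/-! ### The product of the completions at the maximal ideals is versal. -/

namespace AugAlg

theorem ideal_fg (k : Type*) {A : Type*} [Field k] [CommRing A] [Algebra k A]
    [Algebra.FiniteType k A] (I : Ideal A) : I.FG :=
  have := Algebra.FiniteType.isNoetherianRing k A
  IsNoetherian.noetherian I

theorem pairwise_isCoprime_pow {A : Type*} [CommRing A] {ι : Type*} (𝔪 : ι → Ideal A)
    (hmax : ∀ i, (𝔪 i).IsMaximal) (hdistinct : Function.Injective 𝔪) (n : ℕ) :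
    Pairwise (Function.onFun IsCoprime fun i => 𝔪 i ^ n) := fun i j hij =>
  have := hmax i
  have := hmax j
  IsCoprime.pow (Ideal.isCoprime_of_isMaximal (hdistinct.ne hij))

section MaximalIdeals

variable {k A : Type u} [Field k] [IsAlgClosed k] [CommRing A] [Algebra k A]
  [Algebra.FiniteType k A]

/-- The residue fields of a finitely generated algebra over an algebraically closed field `k`
are equal to `k`. -/
theorem algebraMap_quotient_bijective (𝔪 : Ideal A) (hmax : 𝔪.IsMaximal) :
    Function.Bijective (algebraMap k (A ⧸ 𝔪)) := by
  let _ : Field (A ⧸ 𝔪) := Ideal.Quotient.field 𝔪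
  have : Module.Finite k (A ⧸ 𝔪) := finite_of_finite_type_of_isJacobsonRing k (A ⧸ 𝔪)
  exact IsAlgClosed.algebraMap_bijective_of_isIntegral

/-- The isomorphism of the residue field at a maximal ideal with `k`. -/
noncomputable def residueEquiv (𝔪 : Ideal A) (hmax : 𝔪.IsMaximal) : (A ⧸ 𝔪) ≃ₐ[k] k :=
  (AlgEquiv.ofBijective (Algebra.ofId k (A ⧸ 𝔪)) (algebraMap_quotient_bijective 𝔪 hmax)).symm

variable {r : ℕ} (𝔪 : Fin r → Ideal A) (hmax : ∀ i, (𝔪 i).IsMaximal)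

/-- The isomorphism of `⊕ A / 𝔪_i` with `k^r`. -/
noncomputable def piResidueEquiv : (∀ i, A ⧸ 𝔪 i) ≃ₗ[Fin r → k] (Fin r → k) where
  toFun m i := residueEquiv (𝔪 i) (hmax i) (m i)
  invFun c i := (residueEquiv (𝔪 i) (hmax i)).symm (c i)
  map_add' m n := by ext i; simp
  map_smul' c m := by ext i; simp
  left_inv m := by ext i; simp
  right_inv c := by ext i; simp

theorem evalHom_piResidueEquiv (a : A) (i : Fin r) :
    evalHom (A := A) (piResidueEquiv (k := k) 𝔪 hmax) a i =
      residueEquiv (𝔪 i) (hmax i) (Ideal.Quotient.mk (𝔪 i) a) := by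
  rw [evalHom_apply]
  change residueEquiv (𝔪 i) (hmax i)
    (MulOpposite.op a • (residueEquiv (𝔪 i) (hmax i)).symm 1) = _
  rw [map_one]
  congr 1
  rw [op_smul_eq_smul, ← Ideal.Quotient.algebraMap_eq, Algebra.algebraMap_eq_smul_one]

/-- The product of the `𝔪_i`-adic completions of `A`, augmented by the residue fields. -/
noncomputable def piAdic : AugAlg k r where
  carrier := ∀ i, AdicCompletion (𝔪 i) A
  ι := AlgHom.pi fun i => (Algebra.ofId k _).comp (Pi.evalAlgHom k _ i)
  π := AlgHom.pi fun i => (residueEquiv (𝔪 i) (hmax i)).toAlgHom.comp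
    (((AdicCompletion.evalOneₐ (𝔪 i)).restrictScalars k).comp (Pi.evalAlgHom k _ i))
  π_ι c := by
    ext i
    exact AlgHom.commutes ((residueEquiv (𝔪 i) (hmax i)).toAlgHom.comp
      ((AdicCompletion.evalOneₐ (𝔪 i)).restrictScalars k)) (c i)

theorem piAdic_π (x : (piAdic (k := k) 𝔪 hmax).carrier) (i : Fin r) :
    (piAdic (k := k) 𝔪 hmax).π x i =
      residueEquiv (𝔪 i) (hmax i) (AdicCompletion.evalOneₐ (𝔪 i) (x i)) := rfl

/-- The canonical map from `A` to the product of its `𝔪_i`-adic completions. -/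
noncomputable def toPiAdic : A →ₐ[k] (piAdic (k := k) 𝔪 hmax).carrier :=
  AlgHom.pi fun i => IsScalarTower.toAlgHom k A (AdicCompletion (𝔪 i) A)

theorem toPiAdic_apply (a : A) (i : Fin r) :
    toPiAdic (k := k) 𝔪 hmax a i = algebraMap A (AdicCompletion (𝔪 i) A) a := rfl

theorem piAdic_mul_comm (x y : (piAdic (k := k) 𝔪 hmax).carrier) : x * y = y * x :=
  mul_comm (G := ∀ i, AdicCompletion (𝔪 i) A) x y

theorem mem_augIdeal_piAdic_iff (x : (piAdic (k := k) 𝔪 hmax).carrier) :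
    x ∈ (piAdic (k := k) 𝔪 hmax).augIdeal ↔
      ∀ i, x i ∈ (𝔪 i).map (algebraMap A (AdicCompletion (𝔪 i) A)) := by
  rw [mem_augIdeal, funext_iff]
  refine forall_congr' fun i => ?_
  rw [piAdic_π, ← AdicCompletion.evalOneₐ_eq_zero_iff (ideal_fg k _), Pi.zero_apply,
    EmbeddingLike.map_eq_zero_iff]

/-- The powers of the augmentation ideal are computed in each factor, where they are the kernels of
the projections to `A / 𝔪_i ^ n`. Completeness, density and continuity thereby become statements
about these quotients. -/
theorem mem_augIdeal_piAdic_pow_iff (n : ℕ) (x : (piAdic (k := k) 𝔪 hmax).carrier) :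
    x ∈ (piAdic (k := k) 𝔪 hmax).augIdeal ^ n ↔
      ∀ i, AdicCompletion.evalₐ (𝔪 i) n (x i) = 0 := by
  simp only [← AdicCompletion.mem_map_pow_iff (ideal_fg k _)]
  constructor
  · intro hx i
    exact RingHom.map_mem_ideal_pow (R := (piAdic (k := k) 𝔪 hmax).carrier)
      (Pi.evalRingHom (fun i => AdicCompletion (𝔪 i) A) i)
      (fun y hy => (mem_augIdeal_piAdic_iff 𝔪 hmax y).1 hy i) n x hx
  · intro hx
    refine Ideal.mem_pow_of_forall_apply_mem_pow (R := fun i => AdicCompletion (𝔪 i) A)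
      (J := (piAdic (k := k) 𝔪 hmax).augIdeal) (fun i y hy => ?_) hx
    refine (mem_augIdeal_piAdic_iff 𝔪 hmax _).2 fun j => ?_
    by_cases h : j = i
    · subst h; rwa [Pi.single_eq_same]
    · rw [Pi.single_eq_of_ne h]; exact zero_mem _

theorem piAdic_isComplete : (piAdic (k := k) 𝔪 hmax).IsComplete where
  hausdorff x hx := funext fun i => AdicCompletion.ext_evalₐ fun n => by
    rw [(mem_augIdeal_piAdic_pow_iff 𝔪 hmax n x).1 (hx n) i]
    exact (map_zero _).symm
  precomplete f hf := by
    have step : ∀ i n, AdicCompletion.evalₐ (𝔪 i) n (f (n + 1) i) =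
        AdicCompletion.evalₐ (𝔪 i) n (f n i) := fun i n => by
      rw [← sub_eq_zero, ← map_sub]
      exact (mem_augIdeal_piAdic_pow_iff 𝔪 hmax n _).1 (hf n) i
    -- The completeness of each factor is stated for all pairs `m ≤ n`, whereas `hf` compares
    -- consecutive terms.
    have cauchy : ∀ {m n}, m ≤ n → f m - f n ∈ (piAdic (k := k) 𝔪 hmax).augIdeal ^ m := by
      intro m n hmn
      induction n, hmn using Nat.le_induction with
      | base => rw [sub_self]; exact zero_mem _
      | succ n hmn ih =>
        rw [← sub_sub_sub_cancel_right _ _ (f n)]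
        exact sub_mem ih (Ideal.pow_le_pow_right hmn (hf n))
    have lim : ∀ i, ∃ L : AdicCompletion (𝔪 i) A, ∀ n,
        AdicCompletion.evalₐ (𝔪 i) n (L - f n i) = 0 := by
      intro i
      have fg := ideal_fg k (𝔪 i)
      obtain ⟨L, hL⟩ := (AdicCompletion.isAdicComplete (M := A) fg).prec' (fun n => f n i) (by
        intro m n hmn
        rw [SModEq.sub_mem, ← AdicCompletion.evalₐ_eq_zero_iff fg]
        exact (mem_augIdeal_piAdic_pow_iff 𝔪 hmax m _).1 (cauchy hmn) i)
      refine ⟨L, fun n => ?_⟩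
      rw [AdicCompletion.evalₐ_eq_zero_iff fg, ← SModEq.sub_mem]
      exact (hL n).symm
    choose L hL using lim
    exact ⟨L, fun n => (mem_augIdeal_piAdic_pow_iff 𝔪 hmax n _).2 fun i => hL i n⟩

/-- This is the Chinese remainder theorem for the pairwise coprime ideals `𝔪_i ^ n`. -/
theorem toPiAdic_dense (hdistinct : Function.Injective 𝔪)
    (x : (piAdic (k := k) 𝔪 hmax).carrier) (n : ℕ) :
    ∃ a, x - toPiAdic (k := k) 𝔪 hmax a ∈ (piAdic (k := k) 𝔪 hmax).augIdeal ^ n := by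
  choose c hc using fun i =>
    Ideal.Quotient.mk_surjective (AdicCompletion.evalₐ (𝔪 i) n (x i))
  obtain ⟨a, ha⟩ := Ideal.exists_forall_sub_mem_ideal
    (pairwise_isCoprime_pow 𝔪 hmax hdistinct n) c
  refine ⟨a, (mem_augIdeal_piAdic_pow_iff 𝔪 hmax n _).2 fun i => ?_⟩
  change AdicCompletion.evalₐ (𝔪 i) n (x i - algebraMap A (AdicCompletion (𝔪 i) A) a) = 0
  rw [map_sub, AlgHom.commutes, ← hc, Ideal.Quotient.algebraMap_eq, ← map_sub, ← neg_sub,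
    map_neg, Ideal.Quotient.eq_zero_iff_mem.2 (ha i), neg_zero]

/-- By coprimality the intersection of the `𝔪_i ^ n` is their product, that is `(∏ 𝔪_i) ^ n`, and `∏
𝔪_i` is contained in the kernel of evaluation. -/
theorem mem_ker_pow_of_toPiAdic_mem (hdistinct : Function.Injective 𝔪) (n : ℕ) (a : A)
    (ha : toPiAdic (k := k) 𝔪 hmax a ∈ (piAdic (k := k) 𝔪 hmax).augIdeal ^ n) :
    a ∈ RingHom.ker (evalHom (A := A) (piResidueEquiv (k := k) 𝔪 hmax)) ^ n := by
  have mem : ∀ i, a ∈ 𝔪 i ^ n := fun i => by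
    have := (mem_augIdeal_piAdic_pow_iff 𝔪 hmax n _).1 ha i
    rwa [toPiAdic_apply, AlgHom.commutes, Ideal.Quotient.algebraMap_eq,
      Ideal.Quotient.eq_zero_iff_mem] at this
  have le : ∏ i, 𝔪 i ≤ RingHom.ker (evalHom (A := A) (piResidueEquiv (k := k) 𝔪 hmax)) := by
    intro c hc
    rw [RingHom.mem_ker]
    ext i
    rw [evalHom_piResidueEquiv, Ideal.Quotient.eq_zero_iff_mem.2, map_zero, Pi.zero_apply]
    exact (Ideal.prod_le_inf.trans (Finset.inf_le (Finset.mem_univ i))) hc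
  refine Ideal.pow_right_mono le n ?_
  rw [← Finset.prod_pow, Ideal.prod_eq_iInf_of_pairwise_isCoprime]
  · simpa using mem
  · intro i _ j _ hij
    exact pairwise_isCoprime_pow 𝔪 hmax hdistinct n hij

theorem isVersal_piAdic (hdistinct : Function.Injective 𝔪) :
    IsVersal (evalHom (A := A) (piResidueEquiv (k := k) 𝔪 hmax)) (piAdic 𝔪 hmax)
      (toPiAdic 𝔪 hmax) :=
  isVersal_of_dense (piAdic_isComplete 𝔪 hmax) (piAdic_mul_comm 𝔪 hmax)
    (fun a => funext fun i => by rw [evalHom_piResidueEquiv]; rfl)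
    (toPiAdic_dense 𝔪 hmax hdistinct) (mem_ker_pow_of_toPiAdic_mem 𝔪 hmax hdistinct)

end MaximalIdeals

end AugAlg

theorem mainTheorem5 {k A : Type u} [Field k] [IsAlgClosed k] [CommRing A] [Algebra k A]
    [Algebra.FiniteType k A] (r : ℕ) (𝔪 : Fin r → Ideal A) (hmax : ∀ i, (𝔪 i).IsMaximal)
    (hdistinct : Function.Injective 𝔪) :
    (∃ (H : AugAlg k r) (ρ : A →ₐ[k] AugAlg.O (fun i => A ⧸ 𝔪 i) H),
      AugAlg.IsPrecompletion H ρ) ∧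
    ∀ (H : AugAlg k r) (ρ : A →ₐ[k] AugAlg.O (fun i => A ⧸ 𝔪 i) H),
      AugAlg.IsPrecompletion H ρ →
        ∃ e : AugAlg.O (fun i => A ⧸ 𝔪 i) H ≃ₐ[k] (∀ i, AdicCompletion (𝔪 i) A),
          ∀ (a : A) (i : Fin r), e (ρ a) i = algebraMap A (AdicCompletion (𝔪 i) A) a := by
  let b := AugAlg.piResidueEquiv (k := k) 𝔪 hmax
  have versal := AugAlg.isVersal_piAdic (k := k) 𝔪 hmax hdistinct
  constructor
  -- The versal map to the product of completions is transported back to the endomorphism algebra.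
  · refine ⟨AugAlg.piAdic 𝔪 hmax, (AugAlg.endEquiv b _).symm.toAlgHom.comp
      (AugAlg.toPiAdic 𝔪 hmax), (AugAlg.isPrecompletion_iff b _ _).2 ?_⟩
    convert versal
    exact AlgHom.ext fun a => (AugAlg.endEquiv b _).apply_symm_apply _
  · intro H ρ hρ
    obtain ⟨e, he⟩ := versal.exists_algEquiv (AugAlg.piAdic_mul_comm 𝔪 hmax)
      (AugAlg.toPiAdic_dense 𝔪 hmax hdistinct) ((AugAlg.isPrecompletion_iff b H ρ).1 hρ)
    exact ⟨(AugAlg.endEquiv b H).trans e, fun a i => congrFun (he a) i⟩
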